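/- Let $\mathcal L$ be a first-order language and let $\mathcal G$ be an $\mathcal L$-structure that expands a group (the group multiplication is $\emptyset$-definable) and is $\kappa$-saturated for some uncountable cardinal $\kappa>|\mathcal L|$; nothing else is assumed about its theory. "Small" means of cardinality less than $\kappa$. For $A\subseteq\mathcal G$ let $S_x(A)$ be the space of complete types over $A$ in a single variable $x$, with the usual (logic) topology. A global (Keisler) measure $\mu$ is a finitely additive probability measure on the $\mathcal G$-definable subsets of $\mathcal G$; its restriction $\mu|_A$ to the $A$-definable sets corresponds to a unique regular Borel probability measure on $S_x(A)$. Its support $S(\mu)$ is the set of $p\in S_x(\mathcal G)$ such that $\mu(\varphi)>0$ for all $\varphi\in p$; supports of measures over $A$ are defined in the same way. * A global measure $\mu$ is *definable* if there is a small $N\prec\mathcal G$ such that, for every formula $\varphi(x;y)$ over $N$ ($y$ a finite tuple), $\mu(\varphi(x;b))$ depends only on $\mathrm{tp}(b/N)$, and the resulting map $F_\mu^{\varphi}\colon S_y(N)\to[0,1]$, $\mathrm{tp}(b/N)\mapsto\mu(\varphi(x;b))$, is continuous. * It is *invariantly supported* if there is a small $N\prec\mathcal G$ such that every $p\in S(\mu)$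 is $N$-invariant. * For global measures $\mu,\nu$ and a formula $\varphi(x)$ over $\mathcal G$, let $\varphi'(x,y)=\varphi(x\cdot y)$. The triple $(\mu,\nu,\varphi')$ is *Borel*, witnessed by a small $N\prec\mathcal G$ containing the parameters of $\varphi$, if $F_\mu^{\varphi'}(\mathrm{tp}(d/N))=\mu(\varphi(x\cdot d))$ is a well-defined Borel function on $S(\nu|_N)$. The pair $(\mu,\nu)$ is *$*$-Borel* if for each $\varphi$ there is such an $N$, and then the convolution is defined by $(\mu*\nu)(\varphi)=\int_{S(\nu|_N)}F_\mu^{\varphi'}\,d(\nu|_N)$, which does not depend on the choice of the witness $N$. The measure $\mu$ is *idempotent* if $(\mu,\mu)$ is $*$-Borel and $\mu*\mu=\mu$. * For types $p,q\in S_x(\mathcal G)$, $p*q$ is the type $r$ with $\delta_p*\delta_q=\delta_r$, where $\delta_p$ is the Dirac measure of $p$. **Theorem.** Let $\mu$ be a global measure that is definable, invariantly supported and idempotent. Then $(S(\mu),*)$ is a semigroup (all products $p*q$ with $p,q\in S(\mu)$ are defined and lie in $S(\mu)$, and $*$ is associative), and it has no proper closed two-sided ideal: every nonempty closed set $I\subseteq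 S(\mu)$ such that $p*i\in I$ and $i*p\in I$ for all $i\in I$ and $p\in S(\mu)$ equals $S(\mu)$. -/

import Mathlib

open FirstOrder FirstOrder.Language MeasureTheory TopologicalSpace
open scoped Cardinal NNReal ENNReal

universe u v w

set_option linter.unusedSectionVars false

noncomputable section

namespace KeislerConv

section Types

variable (L : FirstOrder.Language.{u, v}) {M : Type w} [L.Structure M] [Nonempty M]

/-- The space of complete types over a parameter set `A ⊆ M` in the tuple of variables `α`
(complete types, in Mathlib's sense, of the theory of `M` with constants for `A`), with the
logic topology, which Mathlib provides. -/
abbrev TypeSpace (A : Set M) (α : Type) : Type (max u v w) :=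
  (L[[A]].completeTheory M).CompleteType α

/-- Type spaces carry the Borel sigma-algebra. -/
instance instMeasurableSpaceTypeSpace (A : Set M) (α : Type) :
    MeasurableSpace (TypeSpace L A α) := borel _

instance instBorelSpaceTypeSpace (A : Set M) (α : Type) : BorelSpace (TypeSpace L A α) := ⟨rfl⟩

variable {L}

/-- The type `tp(b/A)`. -/
abbrev tp (A : Set M) {α : Type} (b : α → M) : TypeSpace L A α :=
  (L[[A]].completeTheory M).typeOf b

/-- A global definable set in the variables `α`. -/
abbrev GlobalDef (L : FirstOrder.Language.{u, v}) (M : Type w) [L.Structure M] (α : Type) :=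
  L.DefinableSet (Set.univ : Set M) α

/-- `Has p D`: the type `p` contains the formulas over `A` that define the set `D`. (Formulas are
identified when they define the same set; see `has_iff`.) -/
def Has {A : Set M} {α : Type} (p : TypeSpace L A α) (D : L.DefinableSet A α) : Prop :=
  ∃ φ : L[[A]].Formula α, (D : Set (α → M)) = {x | φ.Realize x} ∧ Formula.equivSentence φ ∈ p

theorem exists_realize_of_mem {A : Set M} {α : Type} {p : TypeSpace L A α}
    {φ : L[[A]].Formula α} (h : Formula.equivSentence φ ∈ p) : ∃ x : α → M, φ.Realize x := by
  classical
  obtain ⟨N, x, hx⟩ := Theory.exists_modelType_is_realized_in _ p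
  have h1 : φ.Realize x := by
    rw [← hx] at h
    exact Theory.CompleteType.formula_mem_typeOf.1 h
  have h2 : φ.exClosure.Realize N :=
    Formula.exists_realize_equivSentence_iff_realize_exClosure.1
      ⟨x, (Formula.realize_equivSentence_symm N _ x).1 (by simpa using h1)⟩
  have h3 : φ.exClosure.Realize M := (realize_iff_of_model_completeTheory M N _).1 h2
  obtain ⟨y, hy⟩ := Formula.exists_realize_equivSentence_iff_realize_exClosure.2 h3
  exact ⟨y, by simpa using (Formula.realize_equivSentence_symm M _ y).2 hy⟩

/-- Membership of the formula `φ` in a type depends only on the set that `φ` defines. -/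
theorem has_iff {A : Set M} {α : Type} {p : TypeSpace L A α} {D : L.DefinableSet A α}
    {φ : L[[A]].Formula α} (hφ : (D : Set (α → M)) = {x | φ.Realize x}) :
    Has p D ↔ Formula.equivSentence φ ∈ p := by
  refine ⟨fun ⟨ψ, hψ, hp⟩ => ?_, fun h => ⟨φ, hφ, h⟩⟩
  by_contra hn
  obtain ⟨N, x, rfl⟩ := Theory.exists_modelType_is_realized_in _ p
  rw [Theory.CompleteType.formula_mem_typeOf] at hp hn
  have h : Formula.equivSentence (ψ ⊓ φ.not) ∈
      Theory.typeOf (L[[A]].completeTheory M) x := by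
    rw [Theory.CompleteType.formula_mem_typeOf]
    simp [hp, hn]
  obtain ⟨y, hy⟩ := exists_realize_of_mem h
  have hy' : ψ.Realize y ∧ ¬ φ.Realize y := by simpa using hy
  have : y ∈ {x | φ.Realize x} := by
    rw [← hφ, hψ]
    exact hy'.1
  exact hy'.2 this

theorem has_tp {A : Set M} {α : Type} {b : α → M} {D : L.DefinableSet A α} :
    Has (tp A b) D ↔ b ∈ D := by
  obtain ⟨φ, hφ⟩ := D.2
  rw [has_iff (φ := φ) hφ, Theory.CompleteType.formula_mem_typeOf]
  exact (Set.ext_iff.1 hφ b).symm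

theorem has_top {A : Set M} {α : Type} (p : TypeSpace L A α) :
    Has p (⊤ : L.DefinableSet A α) := by
  obtain ⟨N, x, rfl⟩ := Theory.exists_modelType_is_realized_in _ p
  refine ⟨⊤, ?_, ?_⟩
  · ext y
    simp
  · rw [Theory.CompleteType.formula_mem_typeOf]
    simp

theorem has_inf {A : Set M} {α : Type} {p : TypeSpace L A α} {D E : L.DefinableSet A α} :
    Has p (D ⊓ E) ↔ Has p D ∧ Has p E := by
  obtain ⟨φ, hφ⟩ := D.2
  obtain ⟨ψ, hψ⟩ := E.2
  have h : ((D ⊓ E : L.DefinableSet A α) : Set (α → M)) = {x | (φ ⊓ ψ).Realize x} := by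
    ext y
    have h1 := Set.ext_iff.1 hφ y
    have h2 := Set.ext_iff.1 hψ y
    simp only [Set.mem_ofPred_eq, Formula.realize_inf] at h1 h2 ⊢
    exact and_congr h1 h2
  rw [has_iff (φ := φ) hφ, has_iff (φ := ψ) hψ, has_iff (φ := φ ⊓ ψ) h]
  obtain ⟨N, x, rfl⟩ := Theory.exists_modelType_is_realized_in _ p
  simp only [Theory.CompleteType.formula_mem_typeOf, Formula.realize_inf]

theorem has_compl {A : Set M} {α : Type} {p : TypeSpace L A α} {D : L.DefinableSet A α} :
    Has p Dᶜ ↔ ¬ Has p D := by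
  obtain ⟨φ, hφ⟩ := D.2
  have h : ((Dᶜ : L.DefinableSet A α) : Set (α → M)) = {x | φ.not.Realize x} := by
    ext y
    have h1 := Set.ext_iff.1 hφ y
    simp only [Set.mem_ofPred_eq, Formula.realize_not] at h1 ⊢
    exact not_congr h1
  rw [has_iff (φ := φ) hφ, has_iff (φ := φ.not) h]
  obtain ⟨N, x, rfl⟩ := Theory.exists_modelType_is_realized_in _ p
  simp only [Theory.CompleteType.formula_mem_typeOf, Formula.realize_not]

theorem has_sup {A : Set M} {α : Type} {p : TypeSpace L A α} {D E : L.DefinableSet A α} :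
    Has p (D ⊔ E) ↔ Has p D ∨ Has p E := by
  have h : D ⊔ E = (Dᶜ ⊓ Eᶜ)ᶜ := by simp
  rw [h, has_compl, has_inf, has_compl, has_compl]
  tauto

theorem has_mono {A : Set M} {α : Type} {p : TypeSpace L A α} {D E : L.DefinableSet A α}
    (h : D ≤ E) (hD : Has p D) : Has p E := by
  rw [← inf_eq_left.2 h, has_inf] at hD
  exact hD.2

/-- The basic set `[D]` of types that contain the definable set `D`. -/
def basic {A : Set M} {α : Type} (D : L.DefinableSet A α) : Set (TypeSpace L A α) :=
  {p | Has p D}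

theorem basic_isClopen {A : Set M} {α : Type} (D : L.DefinableSet A α) :
    IsClopen (basic D) := by
  obtain ⟨D, φ, rfl⟩ := D
  have : basic (⟨{x | φ.Realize x}, φ, rfl⟩ : L.DefinableSet A α) =
      Theory.typesWith _ (Formula.equivSentence φ) := by
    ext p
    exact has_iff rfl
  exact this ▸ CompleteType.isClopen_typesWith _

theorem basic_le {A : Set M} {α : Type} {D E : L.DefinableSet A α}
    (h : basic D ⊆ basic E) : D ≤ E :=
  fun _ hx => has_tp.1 (h (has_tp.2 hx))

theorem exists_basic_of_mem {A : Set M} {α : Type} {p : TypeSpace L A α}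
    {U : Set (TypeSpace L A α)} (hU : IsOpen U) (hp : p ∈ U) :
    ∃ D : L.DefinableSet A α, Has p D ∧ basic D ⊆ U := by
  obtain ⟨_, ⟨σ, rfl⟩, h1, h2⟩ :=
    CompleteType.isTopologicalBasis_range_typesWith.exists_subset_of_mem_open hp hU
  obtain ⟨φ, rfl⟩ := Formula.equivSentence.surjective σ
  exact ⟨⟨{x | φ.Realize x}, φ, rfl⟩, (has_iff rfl).2 h1, fun q hq => h2 ((has_iff rfl).1 hq)⟩

theorem exists_basic_between {A : Set M} {α : Type} {K U : Set (TypeSpace L A α)}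
    (hK : IsCompact K) (hU : IsOpen U) (h : K ⊆ U) :
    ∃ D : L.DefinableSet A α, K ⊆ basic D ∧ basic D ⊆ U := by
  refine hK.induction_on (p := fun K => ∃ D : L.DefinableSet A α, K ⊆ basic D ∧ basic D ⊆ U)
    ?_ ?_ ?_ ?_
  · exact ⟨⊥, Set.empty_subset _, fun p hp => by
      have := has_compl (p := p) (D := (⊤ : L.DefinableSet A α))
      rw [compl_top] at this
      exact absurd (has_top p) (this.1 hp)⟩
  · rintro s t hst ⟨D, h1, h2⟩
    exact ⟨D, hst.trans h1, h2⟩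
  · rintro s t ⟨D, h1, h2⟩ ⟨E, h3, h4⟩
    refine ⟨D ⊔ E, ?_, ?_⟩
    · rintro p (hp | hp)
      · exact has_sup.2 (Or.inl (h1 hp))
      · exact has_sup.2 (Or.inr (h3 hp))
    · intro p hp
      rcases has_sup.1 hp with hp | hp
      · exact h2 hp
      · exact h4 hp
  · intro p hp
    obtain ⟨D, h1, h2⟩ := exists_basic_of_mem hU (h hp)
    exact ⟨basic D, mem_nhdsWithin_of_mem_nhds ((basic_isClopen D).isOpen.mem_nhds h1),
      D, subset_rfl, h2⟩

end Types

section Measures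

variable {L : FirstOrder.Language.{u, v}} {M : Type w} [L.Structure M]

/-- A Keisler measure over `A` in the variables `α`: a finitely additive probability measure on
the Boolean algebra of `A`-definable subsets of `M^α`. -/
structure KeislerMeasure (L : FirstOrder.Language.{u, v}) {M : Type w} [L.Structure M]
    (A : Set M) (α : Type) where
  toFun : L.DefinableSet A α → ℝ≥0
  map_top : toFun ⊤ = 1
  map_sup : ∀ D E, Disjoint D E → toFun (D ⊔ E) = toFun D + toFun E

instance {A : Set M} {α : Type} :
    CoeFun (KeislerMeasure L A α) (fun _ => L.DefinableSet A α → ℝ≥0) := ⟨KeislerMeasure.toFun⟩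

/-- An `A`-definable set, regarded as a `B`-definable set for `A ⊆ B`. -/
def liftDef {A B : Set M} (h : A ⊆ B) {α : Type} (D : L.DefinableSet A α) : L.DefinableSet B α :=
  ⟨D, D.2.mono h⟩

/-- The restriction `μ|_A` of a Keisler measure over `B` to a smaller parameter set `A`. -/
def KeislerMeasure.restrict {A B : Set M} {α : Type} (μ : KeislerMeasure L B α) (h : A ⊆ B) :
    KeislerMeasure L A α where
  toFun D := μ (liftDef h D)
  map_top := μ.map_top
  map_sup D E hDE := by
    refine μ.map_sup (liftDef h D) (liftDef h E) ?_
    rw [disjoint_iff_inf_le] at hDE ⊢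
    exact fun x hx => hDE hx

theorem KeislerMeasure.mono {A : Set M} {α : Type} (μ : KeislerMeasure L A α)
    {D E : L.DefinableSet A α} (h : D ≤ E) : μ D ≤ μ E := by
  have h1 := μ.map_sup D (E \ D) disjoint_sdiff_self_right
  rw [sup_sdiff_cancel_right h] at h1
  rw [h1]
  exact le_self_add

theorem KeislerMeasure.sup_le {A : Set M} {α : Type} (μ : KeislerMeasure L A α)
    (D E : L.DefinableSet A α) : μ (D ⊔ E) ≤ μ D + μ E := by
  have h1 := μ.map_sup D (E \ D) disjoint_sdiff_self_right
  rw [sup_sdiff_self_right] at h1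
  rw [h1]
  gcongr
  exact μ.mono sdiff_le

theorem definable_instance {A : Set M} {α β : Type} {φ : Set (α ⊕ β → M)} (h : A.Definable L φ)
    (b : β → M) : (Set.univ : Set M).Definable L {a : α → M | Sum.elim a b ∈ φ} := by
  obtain ⟨ψ, rfl⟩ := Set.definable_iff_exists_formula_sum.1 h
  rw [Set.definable_iff_exists_formula_sum]
  refine ⟨ψ.relabel (Sum.elim (fun c : A => Sum.inl ⟨(c : M), trivial⟩)
    (Sum.elim Sum.inr (fun j => Sum.inl ⟨b j, trivial⟩))), ?_⟩
  ext a
  simp only [Set.mem_ofPred_eq, Formula.realize_relabel]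
  refine iff_of_eq (congrArg _ (funext ?_))
  rintro (c | i | j) <;> rfl

/-- The instance `φ(x; b)` of the partitioned formula `φ(x; y)` over `A`. -/
def inst {A : Set M} {α β : Type} (φ : L.DefinableSet A (α ⊕ β)) (b : β → M) : GlobalDef L M α :=
  ⟨{a | Sum.elim a b ∈ φ}, definable_instance φ.2 b⟩

variable [Nonempty M]

/-- The support of a Keisler measure over `A`: the types over `A` all of whose formulas have
positive measure. -/
def KeislerMeasure.supp {A : Set M} {α : Type} (μ : KeislerMeasure L A α) :
    Set (TypeSpace L A α) :=
  {p | ∀ D : L.DefinableSet A α, Has p D → 0 < μ D}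

/-- The infimum of `μ(D)` over the definable sets `D` with `K ⊆ [D]`. -/
def KeislerMeasure.outer {A : Set M} {α : Type} (μ : KeislerMeasure L A α)
    (K : Set (TypeSpace L A α)) : ℝ≥0 :=
  ⨅ D : {D : L.DefinableSet A α // K ⊆ basic D}, μ D.1

theorem KeislerMeasure.outer_le {A : Set M} {α : Type} (μ : KeislerMeasure L A α)
    {K : Set (TypeSpace L A α)} {D : L.DefinableSet A α} (h : K ⊆ basic D) : μ.outer K ≤ μ D :=
  ciInf_le (OrderBot.bddBelow _) (⟨D, h⟩ : {D : L.DefinableSet A α // K ⊆ basic D})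

instance nonempty_basic {A : Set M} {α : Type} (K : Set (TypeSpace L A α)) :
    Nonempty {D : L.DefinableSet A α // K ⊆ basic D} := ⟨⟨⊤, fun p _ => has_top p⟩⟩

theorem KeislerMeasure.outer_union_le {A : Set M} {α : Type} (μ : KeislerMeasure L A α)
    (K₁ K₂ : Set (TypeSpace L A α)) : μ.outer (K₁ ∪ K₂) ≤ μ.outer K₁ + μ.outer K₂ := by
  refine NNReal.le_iInf_add_iInf fun D E => (μ.outer_le ?_).trans (μ.sup_le D.1 E.1)
  rintro p (hp | hp)
  · exact has_sup.2 (Or.inl (D.2 hp))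
  · exact has_sup.2 (Or.inr (E.2 hp))

theorem KeislerMeasure.outer_basic {A : Set M} {α : Type} (μ : KeislerMeasure L A α)
    (D : L.DefinableSet A α) : μ.outer (basic D) = μ D :=
  le_antisymm (μ.outer_le subset_rfl) (le_ciInf fun E => μ.mono (basic_le E.2))

/-- The content on compact sets of types that a Keisler measure induces. -/
def KeislerMeasure.content {A : Set M} {α : Type} (μ : KeislerMeasure L A α) :
    Content (TypeSpace L A α) where
  toFun K := μ.outer K
  mono' _ _ h := le_ciInf fun D => μ.outer_le (h.trans D.2)
  sup_disjoint' K₁ K₂ hd _ h2 := by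
    rw [Compacts.coe_sup]
    refine le_antisymm (μ.outer_union_le _ _) (le_ciInf fun E => ?_)
    obtain ⟨D, hD, hD'⟩ := exists_basic_between K₁.isCompact h2.isOpen_compl
      (Set.disjoint_left.1 hd)
    have hE := μ.map_sup (E.1 ⊓ D) (E.1 \ D) disjoint_inf_sdiff
    rw [sup_inf_sdiff] at hE
    rw [hE]
    refine add_le_add (μ.outer_le fun p hp => has_inf.2 ⟨E.2 (Or.inl hp), hD hp⟩)
      (μ.outer_le fun p hp => ?_)
    rw [sdiff_eq]
    exact has_inf.2 ⟨E.2 (Or.inr hp), has_compl.2 fun h => hD' h hp⟩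
  sup_le' K₁ K₂ := by
    rw [Compacts.coe_sup]
    exact μ.outer_union_le _ _

/-- The regular Borel measure on the type space that corresponds to a Keisler measure: see
`borel_basic`, and `Content.regular` for its regularity. -/
def KeislerMeasure.borel {A : Set M} {α : Type} (μ : KeislerMeasure L A α) :
    Measure (TypeSpace L A α) :=
  μ.content.measure

theorem KeislerMeasure.borel_basic {A : Set M} {α : Type} (μ : KeislerMeasure L A α)
    (D : L.DefinableSet A α) : μ.borel (basic D) = μ D := by
  have hD := basic_isClopen D
  rw [borel, Content.measure_apply _ hD.isOpen.measurableSet,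
    Content.outerMeasure_of_isOpen _ _ hD.isOpen,
    Content.innerContent_of_isCompact _ hD.isClosed.isCompact hD.isOpen]
  exact congrArg _ (μ.outer_basic D)

instance KeislerMeasure.borel_regular {A : Set M} {α : Type} (μ : KeislerMeasure L A α) :
    μ.borel.Regular := Content.regular _

instance KeislerMeasure.borel_isProbability {A : Set M} {α : Type} (μ : KeislerMeasure L A α) :
    IsProbabilityMeasure μ.borel := by
  constructor
  have h := μ.borel_basic ⊤
  rw [μ.map_top] at h
  have : basic (⊤ : L.DefinableSet A α) = Set.univ := Set.eq_univ_of_forall has_top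
  rwa [this] at h

/-- The Dirac measure `δ_p` of a type. -/
def dirac {A : Set M} {α : Type} (p : TypeSpace L A α) : KeislerMeasure L A α :=
  open Classical in
  { toFun := fun D => if Has p D then 1 else 0
    map_top := if_pos (has_top p)
    map_sup := fun D E h => by
      have hn : ¬ (Has p D ∧ Has p E) := fun hp => by
        have := has_inf.2 hp
        rw [disjoint_iff.1 h, ← compl_top, has_compl] at this
        exact this (has_top p)
      by_cases h1 : Has p D <;> by_cases h2 : Has p E <;> simp_all [has_sup] }

end Measures

section Monster

variable {L : FirstOrder.Language.{u, v}} {M : Type w} [L.Structure M] [Nonempty M]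

/-- `M` is `κ`-saturated: every complete type in finitely many variables over a set of fewer than
`κ` parameters is realized in `M`. -/
def IsSaturated (L : FirstOrder.Language.{u, v}) (M : Type w) [L.Structure M] [Nonempty M]
    (κ : Cardinal.{w}) : Prop :=
  ∀ A : Set M, #A < κ → ∀ (n : ℕ) (p : TypeSpace L A (Fin n)), ∃ b : Fin n → M, tp A b = p

/-- A Keisler measure over the whole of `M`. -/
abbrev GlobalMeasure (L : FirstOrder.Language.{u, v}) (M : Type w) [L.Structure M] (α : Type) :=
  KeislerMeasure L (Set.univ : Set M) α

/-- The global measure `μ` is invariant over `A`. -/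
def MeasureInvariantOver {α : Type} (μ : GlobalMeasure L M α) (A : Set M) : Prop :=
  ∀ (n : ℕ) (φ : L.DefinableSet A (α ⊕ Fin n)) (b b' : Fin n → M),
    (tp A b : TypeSpace L A (Fin n)) = tp A b' → μ (inst φ b) = μ (inst φ b')

/-- The global type `p` is invariant over `A`. -/
def TypeInvariantOver {α : Type} (p : TypeSpace L (Set.univ : Set M) α) (A : Set M) : Prop :=
  ∀ (n : ℕ) (φ : L.DefinableSet A (α ⊕ Fin n)) (b b' : Fin n → M),
    (tp A b : TypeSpace L A (Fin n)) = tp A b' → (Has p (inst φ b) ↔ Has p (inst φ b'))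

/-- The map `F_μ^φ(q) = μ(φ(x; b))` for some `b ⊨ q`, on types `q` over `A`. It is used only where
`q` is realized and where the value does not depend on `b`. -/
def fiberMap {A : Set M} {α β : Type} (μ : GlobalMeasure L M α) (φ : L.DefinableSet A (α ⊕ β))
    (q : TypeSpace L A β) : ℝ :=
  open Classical in
  if h : ∃ b : β → M, tp A b = q then (μ (inst φ h.choose) : ℝ) else 0

/-- `μ` is definable: for some small elementary submodel `N`, it is `N`-invariant and all maps
`F_μ^φ : S_y(N) → [0,1]` are continuous. Small means of cardinality less than `κ`. -/
def IsDefinable (κ : Cardinal.{w}) {α : Type} (μ : GlobalMeasure L M α) : Prop :=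
  ∃ N : L.ElementarySubstructure M, #N < κ ∧ MeasureInvariantOver μ (N : Set M) ∧
    ∀ (n : ℕ) (φ : L.DefinableSet (N : Set M) (α ⊕ Fin n)), Continuous (fiberMap μ φ)

/-- `μ` is invariantly supported: for some small elementary submodel `N`, all types in the support
of `μ` are `N`-invariant. -/
def IsInvariantlySupported (κ : Cardinal.{w}) {α : Type} (μ : GlobalMeasure L M α) : Prop :=
  ∃ N : L.ElementarySubstructure M, #N < κ ∧ ∀ p ∈ μ.supp, TypeInvariantOver p (N : Set M)

/-- The restriction of a global measure to a parameter set `A`. -/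
abbrev restr {α : Type} (ν : GlobalMeasure L M α) (A : Set M) : KeislerMeasure L A α :=
  ν.restrict (Set.subset_univ A)

/-- The triple `(μ, ν, φ)` is Borel, as witnessed by the parameter set `N` (over which `φ` is
definable): `F_μ^φ` is well defined and Borel on the support of `ν|_N`. -/
def IsBorelOver {N : Set M} {α β : Type} (μ : GlobalMeasure L M α) (ν : GlobalMeasure L M β)
    (φ : L.DefinableSet N (α ⊕ β)) : Prop :=
  (∀ q ∈ (restr ν N).supp, ∀ d d' : β → M, tp N d = q → tp N d' = q →
    μ (inst φ d) = μ (inst φ d')) ∧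
  Measurable fun q : (restr ν N).supp => fiberMap μ φ q

/-- The triple `(μ, ν, φ)` is Borel: some small elementary submodel containing the parameters of
`φ` is a witness. -/
def IsBorelTriple (κ : Cardinal.{w}) {α β : Type} (μ : GlobalMeasure L M α)
    (ν : GlobalMeasure L M β) (φ : Set (α ⊕ β → M)) : Prop :=
  ∃ N : L.ElementarySubstructure M, #N < κ ∧
    ∃ ψ : L.DefinableSet (N : Set M) (α ⊕ β), (ψ : Set (α ⊕ β → M)) = φ ∧ IsBorelOver μ ν ψ

/-- The integral of `F_μ^φ` over the support of `ν|_N` with respect to the regular Borel measure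
that corresponds to `ν|_N`: the value of the product measure `μ ⊗ ν` at `φ`. -/
def productValue {N : Set M} {α β : Type} (μ : GlobalMeasure L M α) (ν : GlobalMeasure L M β)
    (φ : L.DefinableSet N (α ⊕ β)) : ℝ :=
  ∫ q in (restr ν N).supp, fiberMap μ φ q ∂(restr ν N).borel

end Monster

section Convolution

variable {L : FirstOrder.Language.{u, v}} {G : Type w} [L.Structure G] [Group G]

/-- For the set `D` defined by `φ(x)`, the set defined by `φ'(x, y) = φ(x * y)`. -/
def mulFormula (D : Set (Fin 1 → G)) : Set (Fin 1 ⊕ Fin 1 → G) :=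
  {z | (fun i => z (Sum.inl i) * z (Sum.inr i)) ∈ D}

/-- The pair `(μ, ν)` is `*`-Borel. -/
def IsStarBorel (κ : Cardinal.{w}) (μ ν : GlobalMeasure L G (Fin 1)) : Prop :=
  ∀ D : GlobalDef L G (Fin 1), IsBorelTriple κ μ ν (mulFormula (D : Set (Fin 1 → G)))

/-- `μ * ν = ρ`: the pair `(μ, ν)` is `*`-Borel, and `ρ(φ(x)) = (μ ⊗ ν)(φ(x * y))` for all global
formulas `φ(x)`, where the product is computed over any small elementary submodel that witnesses
that `(μ, ν, φ')` is Borel. -/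
def IsConvolution (κ : Cardinal.{w}) (μ ν ρ : GlobalMeasure L G (Fin 1)) : Prop :=
  IsStarBorel κ μ ν ∧
    ∀ (D : GlobalDef L G (Fin 1)) (N : L.ElementarySubstructure G), #N < κ →
      ∀ ψ : L.DefinableSet (N : Set G) (Fin 1 ⊕ Fin 1),
        (ψ : Set (Fin 1 ⊕ Fin 1 → G)) = mulFormula (D : Set (Fin 1 → G)) → IsBorelOver μ ν ψ →
          (ρ D : ℝ) = productValue μ ν ψ

/-- `μ` is idempotent: it is `*`-Borel and `μ * μ = μ`. -/
def IsIdempotent (κ : Cardinal.{w}) (μ : GlobalMeasure L G (Fin 1)) : Prop :=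
  IsConvolution κ μ μ μ

/-- `p * q = r` for global types: `δ_p * δ_q = δ_r`. -/
def IsTypeProduct (κ : Cardinal.{w}) (p q r : TypeSpace L (Set.univ : Set G) (Fin 1)) : Prop :=
  IsConvolution κ (dirac p) (dirac q) (dirac r)

end Convolution

end KeislerConv

end

set_option linter.unusedSectionVars false

noncomputable section

namespace KeislerConv

/-! ### Types as ultrafilters of definable sets, and the continuous maps between type spaces. -/

section TypeMaps

variable {L : FirstOrder.Language.{u, v}} {M : Type w} [L.Structure M] [Nonempty M]
  {A B : Set M} {α β γ : Type}

/-! Write `D/b` for `{a | a * b ∈ D}`. If `p` is invariant over `N`, then `D ∈ p * q` means `D/b ∈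
p` for a realization `b` of `q|N`, where `N` contains the parameters of `D`; saturation supplies `b`
and invariance makes the choice irrelevant. This is `ProdSpec`. Associativity follows from `(D/c)/b
= D/(b * c)` and from `ProdSpec.tp_mul`: if `c` realizes `q|N` and `b` realizes `p` over a set
containing `N` and `c`, then `b * c` realizes `(p * q)|N`.

Definability and idempotence give `μ(D) = ∫ f dμ|N`, where `f(tp(b/N)) = μ(D/b)` is continuous.
Hence if `D ∈ p * q` with `p, q` in the support, then `f` is positive at the support point `q|N`, so
`μ(D) > 0`; this puts `p * q` in the support.

For a closed ideal `I` missing a point `p₀` of the support, choose `D ∈ p₀` with `[D]` disjoint from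
`I`. Let `f` attain its maximum over the support at `r`, and let `c` realize `r|N`. The same formula
for `D/c` writes `μ(D/c) = max f` as the mean of `μ(D/(b * c))`, whose values on the support are
values of `f` at products `q * r`, hence at most the maximum. So they all equal it. For `b`
realizing some `i ∈ I` the value is `0`: otherwise some `p` in the support contains `D/(b * c)`, so
`D ∈ p * (i * r) ∈ I`. Thus `max f = 0` and `μ(D) = 0`, although `D ∈ p₀`. -/

theorem type_ext {p q : TypeSpace L A α} (h : ∀ D, Has p D → Has q D) : p = q := by
  by_contra hne
  obtain ⟨D, h1, h2⟩ := exists_basic_of_mem (isOpen_compl_singleton (x := q)) (p := p) hne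
  exact h2 (h D h1) rfl

theorem continuous_of_isOpen_preimage_basic {X : Type*} [TopologicalSpace X]
    {f : X → TypeSpace L A α} (h : ∀ D, IsOpen (f ⁻¹' basic D)) : Continuous f := by
  rw [continuous_def]
  intro U hU
  rw [isOpen_iff_mem_nhds]
  intro x hx
  obtain ⟨D, h1, h2⟩ := exists_basic_of_mem hU hx
  exact Filter.mem_of_superset ((h D).mem_nhds h1) fun y hy => h2 hy

/-- Every ultrafilter of definable sets is a complete type. -/
theorem exists_type_of_ultrafilter (U : L.DefinableSet A α → Prop) (htop : U ⊤)
    (hinf : ∀ D E, U D → U E → U (D ⊓ E)) (hcompl : ∀ D, U Dᶜ ↔ ¬ U D) :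
    ∃ p : TypeSpace L A α, ∀ D, Has p D ↔ U D := by
  have hbot : ¬ U ⊥ := by
    rw [← compl_top, hcompl]
    exact not_not_intro htop
  have : Nonempty {D // U D} := ⟨⟨⊤, htop⟩⟩
  -- Compactness: the sets `[D]` with `U D` are closed, directed under intersection, and nonempty
  -- because only `⊥` has `[D]` empty.
  obtain ⟨p, hp⟩ := IsCompact.nonempty_iInter_of_directed_nonempty_isCompact_isClosed
    (fun D : {D // U D} => basic D.1)
    (fun D E => ⟨⟨D.1 ⊓ E.1, hinf _ _ D.2 E.2⟩, fun p hp => (has_inf.1 hp).1,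
      fun p hp => (has_inf.1 hp).2⟩)
    (fun D => by
      by_contra hne
      have : D.1 = ⊥ := le_bot_iff.1 (basic_le fun p hp => (hne ⟨p, hp⟩).elim)
      exact hbot (this ▸ D.2))
    (fun D => (basic_isClopen D.1).isClosed.isCompact) (fun D => (basic_isClopen D.1).isClosed)
  have hU : ∀ D, U D → Has p D := fun D hD => Set.mem_iInter.1 hp ⟨D, hD⟩
  refine ⟨p, fun D => ⟨fun hD => ?_, hU D⟩⟩
  by_contra hn
  exact has_compl.1 (hU _ ((hcompl D).2 hn)) hD

/-- The preimage of a definable set under a map that pulls definable sets back to definable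
sets. -/
def comapDef (g : (β → M) → γ → M)
    (hg : ∀ E : L.DefinableSet A γ, B.Definable L (g ⁻¹' (E : Set (γ → M))))
    (E : L.DefinableSet A γ) : L.DefinableSet B β :=
  ⟨g ⁻¹' E, hg E⟩

theorem exists_mapType (g : (β → M) → γ → M)
    (hg : ∀ E : L.DefinableSet A γ, B.Definable L (g ⁻¹' (E : Set (γ → M))))
    (p : TypeSpace L B β) :
    ∃ q : TypeSpace L A γ, ∀ E, Has q E ↔ Has p (comapDef g hg E) :=
  exists_type_of_ultrafilter (fun E => Has p (comapDef g hg E)) (has_top p)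
    (fun _ _ hD hE => has_inf.2 ⟨hD, hE⟩) (fun D => has_compl (D := comapDef g hg D))

/-- The map on types that a map with definable preimages induces. -/
def mapType (g : (β → M) → γ → M)
    (hg : ∀ E : L.DefinableSet A γ, B.Definable L (g ⁻¹' (E : Set (γ → M))))
    (p : TypeSpace L B β) : TypeSpace L A γ :=
  (exists_mapType g hg p).choose

theorem has_mapType {g : (β → M) → γ → M}
    {hg : ∀ E : L.DefinableSet A γ, B.Definable L (g ⁻¹' (E : Set (γ → M)))}
    {p : TypeSpace L B β} {E : L.DefinableSet A γ} :
    Has (mapType g hg p) E ↔ Has p (comapDef g hg E) :=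
  (exists_mapType g hg p).choose_spec E

theorem mapType_tp (g : (β → M) → γ → M)
    (hg : ∀ E : L.DefinableSet A γ, B.Definable L (g ⁻¹' (E : Set (γ → M)))) (b : β → M) :
    mapType g hg (tp B b) = tp A (g b) := by
  refine type_ext fun E hE => ?_
  rw [has_mapType, has_tp] at hE
  exact has_tp.2 hE

theorem continuous_mapType (g : (β → M) → γ → M)
    (hg : ∀ E : L.DefinableSet A γ, B.Definable L (g ⁻¹' (E : Set (γ → M)))) :
    Continuous (mapType g hg) :=
  continuous_of_isOpen_preimage_basic fun E => by
    have : mapType g hg ⁻¹' basic E = basic (comapDef g hg E) := by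
      ext p
      exact has_mapType
    exact this ▸ (basic_isClopen _).isOpen

/-- The restriction of a type to a smaller parameter set. -/
def resType (h : A ⊆ B) (p : TypeSpace L B α) : TypeSpace L A α :=
  mapType id (fun E => E.2.mono h) p

theorem has_resType {h : A ⊆ B} {p : TypeSpace L B α} {D : L.DefinableSet A α} :
    Has (resType h p) D ↔ Has p (liftDef h D) :=
  has_mapType

theorem resType_tp (h : A ⊆ B) (b : α → M) : resType h (tp B b : TypeSpace L B α) = tp A b :=
  mapType_tp _ _ _

theorem continuous_resType (h : A ⊆ B) :
    Continuous (resType h : TypeSpace L B α → TypeSpace L A α) :=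
  continuous_mapType _ _

theorem resType_resType {C : Set M} (h : A ⊆ B) (h' : B ⊆ C) (p : TypeSpace L C α) :
    resType h (resType h' p) = resType (h.trans h') p := by
  refine type_ext fun D hD => ?_
  rw [has_resType, has_resType] at hD
  exact has_resType.2 hD

theorem mem_iff_of_tp_eq {b : α → M} {p : TypeSpace L A α} (h : tp A b = p)
    (D : L.DefinableSet A α) : b ∈ D ↔ Has p D := by
  rw [← h, has_tp]

end TypeMaps

/-! ### Supports of Keisler measures. -/

section Support

variable {L : FirstOrder.Language.{u, v}} {M : Type w} [L.Structure M] [Nonempty M]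
  {A B : Set M} {α : Type}

theorem KeislerMeasure.isClosed_supp (ν : KeislerMeasure L A α) : IsClosed ν.supp := by
  rw [← isOpen_compl_iff, isOpen_iff_mem_nhds]
  intro p hp
  simp only [supp, Set.mem_compl_iff, Set.mem_ofPred_eq, not_forall] at hp
  obtain ⟨D, hD, h0⟩ := hp
  exact Filter.mem_of_superset ((basic_isClopen D).isOpen.mem_nhds hD) fun q hq hq' => h0 (hq' D hq)

/-- By inner regularity it is enough to look at compact subsets of the complement, and each of these
is covered by finitely many null sets `[D]`. -/
theorem KeislerMeasure.borel_compl_supp (ν : KeislerMeasure L A α) : ν.borel ν.suppᶜ = 0 := by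
  rw [ν.isClosed_supp.isOpen_compl.measure_eq_iSup_isCompact]
  simp only [ENNReal.iSup_eq_zero]
  intro K hK hc
  refine hc.measure_zero_of_nhdsWithin fun p hp => ?_
  have := hK hp
  simp only [supp, Set.mem_compl_iff, Set.mem_ofPred_eq, not_forall] at this
  obtain ⟨D, hD, h0⟩ := this
  refine ⟨basic D, mem_nhdsWithin_of_mem_nhds ((basic_isClopen D).isOpen.mem_nhds hD), ?_⟩
  rw [ν.borel_basic, nonpos_iff_eq_zero.1 (not_lt.1 h0), ENNReal.coe_zero]

theorem KeislerMeasure.borel_supp (ν : KeislerMeasure L A α) : ν.borel ν.supp = 1 := by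
  rw [← prob_compl_eq_zero_iff ν.isClosed_supp.measurableSet]
  exact ν.borel_compl_supp

theorem KeislerMeasure.exists_mem_supp (ν : KeislerMeasure L A α) {D : L.DefinableSet A α}
    (hD : 0 < ν D) : ∃ p ∈ ν.supp, Has p D := by
  by_contra! hn
  have h1 : basic D ⊆ ν.suppᶜ := fun p hp hs => hn p hs hp
  have h2 := measure_mono_null h1 ν.borel_compl_supp
  rw [ν.borel_basic, ENNReal.coe_eq_zero] at h2
  exact hD.ne' h2

theorem KeislerMeasure.resType_mem_supp (ν : KeislerMeasure L B α) (h : A ⊆ B)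
    {p : TypeSpace L B α} (hp : p ∈ ν.supp) : resType h p ∈ (ν.restrict h).supp :=
  fun _ hD => hp _ (has_resType.1 hD)

/-- The image of the compact support is closed. A clopen set separating `q` from it would have
positive measure, and hence would contain the restriction of a point of the support. -/
theorem KeislerMeasure.exists_resType_eq (ν : KeislerMeasure L B α) (h : A ⊆ B)
    {q : TypeSpace L A α} (hq : q ∈ (ν.restrict h).supp) : ∃ p ∈ ν.supp, resType h p = q := by
  by_contra! hn
  have hc : IsClosed (resType h '' ν.supp) :=
    (ν.isClosed_supp.isCompact.image (continuous_resType h)).isClosed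
  obtain ⟨D, hD, hD'⟩ := exists_basic_of_mem hc.isOpen_compl (p := q)
    (by rintro ⟨p, hp, he⟩; exact hn p hp he)
  obtain ⟨p, hp, hpD⟩ := ν.exists_mem_supp (D := liftDef h D) (hq D hD)
  exact hD' (has_resType.2 hpD) ⟨p, hp, rfl⟩

theorem KeislerMeasure.integrableOn_supp (ν : KeislerMeasure L A α) {f : TypeSpace L A α → ℝ}
    (hf : Continuous f) : IntegrableOn f ν.supp ν.borel :=
  hf.continuousOn.integrableOn_compact ν.isClosed_supp.isCompact

/-- Almost everywhere becomes everywhere: by continuity a nonzero value at `q` persists on some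
`[D]` containing `q`, and such a set has positive measure. -/
theorem KeislerMeasure.eq_zero_of_integral_eq_zero (ν : KeislerMeasure L A α)
    {f : TypeSpace L A α → ℝ} (hf : Continuous f) (h0 : ∀ q ∈ ν.supp, 0 ≤ f q)
    (hi : ∫ q in ν.supp, f q ∂ν.borel = 0) : ∀ q ∈ ν.supp, f q = 0 := by
  intro q hq
  have hm := ν.isClosed_supp.measurableSet
  rw [setIntegral_eq_zero_iff_of_nonneg_ae ((ae_restrict_iff' hm).2 (.of_forall h0))
    (ν.integrableOn_supp hf)] at hi
  by_contra hne
  obtain ⟨D, hD, hD'⟩ := exists_basic_of_mem (isOpen_ne_fun hf continuous_const (g := fun _ => 0))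
    (p := q) hne
  have h1 : ν.borel.restrict ν.supp (basic D) = 0 := measure_mono_null hD' (ae_iff.1 hi)
  rw [Measure.restrict_apply (basic_isClopen D).isOpen.measurableSet] at h1
  have h2 : ν.borel (basic D) = 0 := by
    refine measure_mono_null (fun p hp => ?_) (measure_union_null h1 ν.borel_compl_supp)
    by_cases hs : p ∈ ν.supp
    · exact Or.inl ⟨hp, hs⟩
    · exact Or.inr hs
  rw [ν.borel_basic, ENNReal.coe_eq_zero] at h2
  exact (hq D hD).ne' h2

theorem dirac_pos {p : TypeSpace L A α} {D : L.DefinableSet A α} : 0 < dirac p D ↔ Has p D := by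
  by_cases h : Has p D <;> simp [dirac, h]

theorem dirac_eq_iff {β : Type} {p : TypeSpace L A α} {q : TypeSpace L B β}
    {D : L.DefinableSet A α} {E : L.DefinableSet B β} :
    dirac p D = dirac q E ↔ (Has p D ↔ Has q E) := by
  by_cases h : Has p D <;> by_cases h' : Has q E <;> simp [dirac, h, h']

theorem supp_restrict_dirac (h : A ⊆ B) (p : TypeSpace L B α) :
    ((dirac p).restrict h).supp = {resType h p} := by
  ext q
  constructor
  · intro hq
    exact type_ext fun D hD => has_resType.2 (dirac_pos.1 (hq D hD))
  · rintro rfl D hD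
    exact dirac_pos.2 (has_resType.1 hD)

end Support

/-! ### Invariance and definability pass to larger parameter sets. -/

section Parameters

variable {L : FirstOrder.Language.{u, v}} {M : Type w} [L.Structure M] [Nonempty M]
  {A B : Set M} {α β : Type}

/-- A formula over `B` is an instance of a formula over `A` in more variables. -/
theorem exists_extend_tuple (A : Set M) [Finite β] (ψ : L.DefinableSet B (α ⊕ β)) :
    ∃ (n : ℕ) (g : (β → M) → Fin n → M) (φ : L.DefinableSet A (α ⊕ Fin n)),
      (∀ b, inst φ (g b) = inst ψ b) ∧ ∀ j, (∃ i, ∀ b, g b j = b i) ∨ ∃ c ∈ B, ∀ b, g b j = c := by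
  -- The finitely many parameters `A₀` of `ψ` become extra variables, so that `φ` needs no
  -- parameters at all; `g` appends the constants `A₀` to a tuple.
  obtain ⟨A₀, hA₀, hψ⟩ := Set.definable_iff_finitely_definable.1 ψ.2
  obtain ⟨θ, hθ⟩ := Set.definable_iff_exists_formula_sum.1 hψ
  obtain ⟨n, ⟨e⟩⟩ := Finite.exists_equiv_fin (β ⊕ (A₀ : Set M))
  refine ⟨n, fun b => Sum.elim b (fun c : (A₀ : Set M) => (c : M)) ∘ e.symm,
    ⟨{z | θ.Realize (z ∘ Sum.elim (fun c => Sum.inr (e (Sum.inr c)))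
      (Sum.map id fun i => e (Sum.inl i)))}, ?_⟩, fun b => ?_, fun j => ?_⟩
  · refine Set.Definable.mono (Set.Definable.preimage_comp (s := {z | θ.Realize z}) _ ?_)
      (Set.empty_subset A)
    exact Set.empty_definable_iff.2 ⟨θ, rfl⟩
  · apply Subtype.ext
    ext a
    have h1 := Set.ext_iff.1 hθ (Sum.elim a b)
    have h2 : Sum.elim a (Sum.elim b (fun c : (A₀ : Set M) => (c : M)) ∘ e.symm) ∘
        Sum.elim (fun c => Sum.inr (e (Sum.inr c))) (Sum.map id fun i => e (Sum.inl i)) =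
        Sum.elim (fun c : (A₀ : Set M) => (c : M)) (Sum.elim a b) := by
      funext k
      rcases k with c | i | j <;> simp
    refine Iff.trans ?_ h1.symm
    change θ.Realize _ ↔ θ.Realize _
    rw [h2]
  · rcases h : e.symm j with i | c
    · exact Or.inl ⟨i, fun b => by simp [h]⟩
    · exact Or.inr ⟨c, hA₀ c.2, fun b => by simp [h]⟩

theorem definable_preimage_extend [Finite β] {n : ℕ} {g : (β → M) → Fin n → M} (h : A ⊆ B)
    (hg : ∀ j, (∃ i, ∀ b, g b j = b i) ∨ ∃ c ∈ B, ∀ b, g b j = c)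
    (E : L.DefinableSet A (Fin n)) : B.Definable L (g ⁻¹' (E : Set (Fin n → M))) := by
  refine Set.Definable.preimage_map (fun j => ?_) (E.2.mono h)
  rcases hg j with ⟨i, hi⟩ | ⟨c, hc, hj⟩
  · simp only [hi]
    exact Set.DefinableFun.proj L
  · simp only [hj]
    exact L.definableFun_const _ hc

/-- Tuples with the same type over `B` still have the same type over `A` once constants from `B` are
appended to both. -/
theorem MeasureInvariantOver.mono {μ : GlobalMeasure L M α} (hμ : MeasureInvariantOver μ A)
    (h : A ⊆ B) : MeasureInvariantOver μ B := by
  intro n ψ b b' hb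
  obtain ⟨m, g, φ, hφ, hg⟩ := exists_extend_tuple A ψ
  rw [← hφ, ← hφ]
  refine hμ m φ _ _ ?_
  rw [← mapType_tp g (definable_preimage_extend h hg), hb, mapType_tp]

theorem measureInvariantOver_dirac {p : TypeSpace L (Set.univ : Set M) α} :
    MeasureInvariantOver (dirac p) A ↔ TypeInvariantOver p A := by
  simp only [MeasureInvariantOver, TypeInvariantOver, dirac_eq_iff]

theorem TypeInvariantOver.mono {p : TypeSpace L (Set.univ : Set M) α}
    (hp : TypeInvariantOver p A) (h : A ⊆ B) : TypeInvariantOver p B :=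
  measureInvariantOver_dirac.1 ((measureInvariantOver_dirac.2 hp).mono h)

theorem fiberMap_eq {μ : GlobalMeasure L M α} {φ : L.DefinableSet A (α ⊕ β)}
    {q : TypeSpace L A β} {b : β → M} (hb : tp A b = q)
    (hμ : ∀ b', tp A b' = q → μ (inst φ b') = μ (inst φ b)) :
    fiberMap μ φ q = μ (inst φ b) := by
  have h : ∃ b : β → M, tp A b = q := ⟨b, hb⟩
  rw [fiberMap, dif_pos h, hμ _ h.choose_spec]

theorem MeasureInvariantOver.fiberMap_tp {μ : GlobalMeasure L M α}
    (hμ : MeasureInvariantOver μ A) {n : ℕ} (φ : L.DefinableSet A (α ⊕ Fin n)) (b : Fin n → M) :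
    fiberMap μ φ (tp A b) = μ (inst φ b) :=
  fiberMap_eq rfl fun b' hb' => hμ n φ b' b hb'

/-- The fiber map over `B` is one over `A` composed with the continuous map on types that appends
constants. Since all types over `B` are realized, the default value `0` of `fiberMap` never
interferes. -/
theorem continuous_fiberMap_of_subset {μ : GlobalMeasure L M α} (hμ : MeasureInvariantOver μ A)
    (hc : ∀ (n : ℕ) (φ : L.DefinableSet A (α ⊕ Fin n)), Continuous (fiberMap μ φ))
    (h : A ⊆ B) {n : ℕ} (hB : ∀ p : TypeSpace L B (Fin n), ∃ b, tp B b = p)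
    (ψ : L.DefinableSet B (α ⊕ Fin n)) : Continuous (fiberMap μ ψ) := by
  obtain ⟨m, g, φ, hφ, hg⟩ := exists_extend_tuple A ψ
  have : fiberMap μ ψ = fiberMap μ φ ∘ mapType g (definable_preimage_extend h hg) := by
    funext q
    obtain ⟨b, rfl⟩ := hB q
    rw [(hμ.mono h).fiberMap_tp, Function.comp_apply, mapType_tp, hμ.fiberMap_tp, hφ]
  rw [this]
  exact (hc m φ).comp (continuous_mapType _ _)

end Parameters

end KeislerConv

namespace KeislerConv

/-! ### Small parameter sets and small elementary submodels. -/

section Small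

variable {L : FirstOrder.Language.{u, v}} {M : Type w} [L.Structure M] [Nonempty M]
  {κ : Cardinal.{w}}

theorem mk_union_lt (hκ : ℵ₀ < κ) {A B : Set M} (hA : #A < κ) (hB : #B < κ) :
    #(A ∪ B : Set M) < κ :=
  (Cardinal.mk_union_le A B).trans_lt (Cardinal.add_lt_of_lt hκ.le hA hB)

theorem mk_lt_of_finite (hκ : ℵ₀ < κ) {A : Set M} (hA : A.Finite) : #A < κ :=
  hA.lt_aleph0.trans hκ

theorem exists_elementarySubstructure_mk_lt (hκ : ℵ₀ < κ)
    (hL : Cardinal.lift.{w} L.card < Cardinal.lift.{max u v} κ) {A : Set M} (hA : #A < κ) :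
    ∃ N : L.ElementarySubstructure M, A ⊆ N ∧ #N < κ := by
  -- Downward Löwenheim–Skolem needs a target cardinal of at most `#M`; a small `M` is its own
  -- witness.
  by_cases hM : #M < κ
  · exact ⟨⊤, fun _ _ => trivial, (Cardinal.mk_set_le _).trans_lt hM⟩
  let c : Cardinal.{max u v w} :=
    max ℵ₀ (max (Cardinal.lift.{max u v} #A) (Cardinal.lift.{w} L.card))
  have hc : c < Cardinal.lift.{max u v} κ :=
    max_lt (Cardinal.aleph0_lt_lift.2 hκ) (max_lt (Cardinal.lift_lt.2 hA) hL)
  obtain ⟨N, hAN, hN⟩ := exists_elementarySubstructure_card_eq L A c (le_max_left _ _)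
    (by
      rw [Cardinal.lift_umax.{w, max u v}, Cardinal.lift_id'.{w, max u v w}]
      exact (le_max_left _ _).trans (le_max_right _ _))
    (by
      rw [Cardinal.lift_umax.{max u v, w}, Cardinal.lift_id'.{max u v, w}]
      exact (le_max_right _ _).trans (le_max_right _ _))
    (by
      rw [Cardinal.lift_umax.{w, max u v}, Cardinal.lift_id'.{w, max u v}]
      exact hc.le.trans (Cardinal.lift_le.2 (not_lt.1 hM)))
  rw [Cardinal.lift_umax.{w, max u v}, Cardinal.lift_id'.{w, max u v}] at hN
  exact ⟨N, hAN, Cardinal.lift_lt.1 (hN.trans_lt hc)⟩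

theorem exists_finite_definable {α : Type} (D : GlobalDef L M α) :
    ∃ A : Set M, A.Finite ∧ A.Definable L (D : Set (α → M)) := by
  obtain ⟨A, -, hA⟩ := Set.definable_iff_finitely_definable.1 D.2
  exact ⟨A, A.finite_toSet, hA⟩

end Small

/-! ### Right translates and the product of types. -/

section Translates

variable {L : FirstOrder.Language.{u, v}} {G : Type w} [L.Structure G] [Group G]

theorem definable_mulFormula
    (hmul : (∅ : Set G).DefinableFun L (fun z : Fin 2 → G => z 0 * z 1))
    {A : Set G} {D : Set (Fin 1 → G)} (hD : A.Definable L D) :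
    A.Definable L (mulFormula D) := by
  refine Set.Definable.preimage_map (F := fun (z : Fin 1 ⊕ Fin 1 → G) i =>
    z (Sum.inl i) * z (Sum.inr i)) (fun i => ?_) hD
  refine Set.DefinableFun.comp (g := fun (z : Fin 1 ⊕ Fin 1 → G) =>
    ![z (Sum.inl i), z (Sum.inr i)]) (fun j => ?_) hmul.of_empty
  fin_cases j
  · exact Set.DefinableFun.proj L
  · exact Set.DefinableFun.proj L

theorem definable_mul_right_preimage
    (hmul : (∅ : Set G).DefinableFun L (fun z : Fin 2 → G => z 0 * z 1))
    {A : Set G} {D : Set (Fin 1 → G)} (hD : A.Definable L D)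
    {b : Fin 1 → G} (hb : ∀ i, b i ∈ A) : A.Definable L {a | a * b ∈ D} := by
  refine Set.Definable.preimage_map (F := fun (a : Fin 1 → G) => Sum.elim a b) ?_
    (definable_mulFormula hmul hD)
  rintro (i | i)
  · exact Set.DefinableFun.proj L
  · exact L.definableFun_const _ (hb i)

variable (hmul : (∅ : Set G).DefinableFun L (fun z : Fin 2 → G => z 0 * z 1))

/-- The right translate of the definable set `D` by `b⁻¹`, defined by `x * b ∈ D`. -/
def rdiv (D : GlobalDef L G (Fin 1)) (b : Fin 1 → G) : GlobalDef L G (Fin 1) :=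
  ⟨{a | a * b ∈ D}, definable_mul_right_preimage hmul D.2 fun _ => trivial⟩

theorem rdiv_rdiv (D : GlobalDef L G (Fin 1)) (b c : Fin 1 → G) :
    rdiv hmul (rdiv hmul D c) b = rdiv hmul D (b * c) := by
  apply Subtype.ext
  ext a
  change a * b * c ∈ D ↔ a * (b * c) ∈ D
  rw [mul_assoc]

theorem inst_eq_rdiv {A : Set G} {ψ : L.DefinableSet A (Fin 1 ⊕ Fin 1)}
    {D : GlobalDef L G (Fin 1)}
    (hψ : (ψ : Set (Fin 1 ⊕ Fin 1 → G)) = mulFormula (D : Set (Fin 1 → G))) (b : Fin 1 → G) :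
    inst ψ b = rdiv hmul D b := by
  apply Subtype.ext
  ext a
  exact Set.ext_iff.1 hψ (Sum.elim a b)

theorem rdiv_compl (D : GlobalDef L G (Fin 1)) (b : Fin 1 → G) :
    rdiv hmul Dᶜ b = (rdiv hmul D b)ᶜ := rfl

/-- `r` is the product of the `N₀`-invariant type `p` and the type `q`: a definable set `D`
is in `r` if and only if its translate by a realization of `q` is in `p`. -/
def ProdSpec (κ : Cardinal.{w}) (N₀ : Set G)
    (p q r : TypeSpace L (Set.univ : Set G) (Fin 1)) : Prop :=
  ∀ N : Set G, N₀ ⊆ N → #N < κ → ∀ D : GlobalDef L G (Fin 1), N.Definable L (D : Set (Fin 1 → G)) →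
    ∀ b : Fin 1 → G, tp N b = resType (Set.subset_univ N) q →
      (Has r D ↔ Has p (rdiv hmul D b))

variable {hmul} {κ : Cardinal.{w}} {N₀ N : Set G}
  {p q r s t x y : TypeSpace L (Set.univ : Set G) (Fin 1)}

theorem TypeInvariantOver.has_rdiv_iff (hp : TypeInvariantOver p N) {D : GlobalDef L G (Fin 1)}
    (hD : N.Definable L (D : Set (Fin 1 → G))) {b b' : Fin 1 → G}
    (hb : (tp N b : TypeSpace L N (Fin 1)) = tp N b') :
    Has p (rdiv hmul D b) ↔ Has p (rdiv hmul D b') :=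
  hp 1 ⟨_, definable_mulFormula hmul hD⟩ b b' hb

theorem exists_prodSpec (hκ : ℵ₀ < κ) (hsat : IsSaturated L G κ) (hN₀ : #N₀ < κ)
    (hp : TypeInvariantOver p N₀) (q : TypeSpace L (Set.univ : Set G) (Fin 1)) :
    ∃ r, ProdSpec hmul κ N₀ p q r := by
  let U : GlobalDef L G (Fin 1) → Prop := fun D => ∃ N : Set G, N₀ ⊆ N ∧ #N < κ ∧
    N.Definable L (D : Set (Fin 1 → G)) ∧
      ∃ b : Fin 1 → G, tp N b = resType (Set.subset_univ N) q ∧ Has p (rdiv hmul D b)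
  have key : ∀ N : Set G, N₀ ⊆ N → #N < κ → ∀ D : GlobalDef L G (Fin 1),
      N.Definable L (D : Set (Fin 1 → G)) → ∀ b : Fin 1 → G, tp N b = resType (Set.subset_univ N) q →
        (U D ↔ Has p (rdiv hmul D b)) := by
    intro N hN hNκ D hD b hb
    refine ⟨?_, fun h => ⟨N, hN, hNκ, hD, b, hb, h⟩⟩
    rintro ⟨N', hN', hNκ', hD', b', hb', h⟩
    -- A realization of `q` over both parameter sets links `b` to `b'` by invariance.
    obtain ⟨d, hd⟩ := hsat (N ∪ N') (mk_union_lt hκ hNκ hNκ') 1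
      (resType (Set.subset_univ _) q)
    have h1 : (tp N' b' : TypeSpace L N' (Fin 1)) = tp N' d := by
      rw [hb', ← resType_tp (L := L) Set.subset_union_right d, hd, resType_resType]
    have h2 : (tp N b : TypeSpace L N (Fin 1)) = tp N d := by
      rw [hb, ← resType_tp (L := L) Set.subset_union_left d, hd, resType_resType]
    exact ((hp.mono hN).has_rdiv_iff hD h2).2 (((hp.mono hN').has_rdiv_iff hD' h1).1 h)
  have hex : ∀ D E : GlobalDef L G (Fin 1), ∃ N : Set G, N₀ ⊆ N ∧ #N < κ ∧
      N.Definable L (D : Set (Fin 1 → G)) ∧ N.Definable L (E : Set (Fin 1 → G)) ∧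
      ∃ b : Fin 1 → G, tp N b = resType (Set.subset_univ N) q := by
    intro D E
    obtain ⟨A, hA, hD⟩ := exists_finite_definable D
    obtain ⟨B, hB, hE⟩ := exists_finite_definable E
    have hs : #(N₀ ∪ (A ∪ B) : Set G) < κ :=
      mk_union_lt hκ hN₀ (mk_lt_of_finite hκ (hA.union hB))
    exact ⟨N₀ ∪ (A ∪ B), Set.subset_union_left, hs,
      hD.mono (Set.subset_union_left.trans Set.subset_union_right),
      hE.mono (Set.subset_union_right.trans Set.subset_union_right), hsat _ hs 1 _⟩
  suffices h : ∃ r : TypeSpace L (Set.univ : Set G) (Fin 1), ∀ D, Has r D ↔ U D by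
    obtain ⟨r, hr⟩ := h
    exact ⟨r, fun N hN hNκ D hD b hb => (hr D).trans (key N hN hNκ D hD b hb)⟩
  refine exists_type_of_ultrafilter U ?_ ?_ ?_
  · obtain ⟨N, hN, hNκ, hD, -, b, hb⟩ := hex ⊤ ⊤
    exact (key N hN hNκ _ hD b hb).2 (has_top p)
  · intro D E hUD hUE
    obtain ⟨N, hN, hNκ, hD, hE, b, hb⟩ := hex D E
    exact (key N hN hNκ _ (hD.inter hE) b hb).2
      (has_inf.2 ⟨(key N hN hNκ _ hD b hb).1 hUD, (key N hN hNκ _ hE b hb).1 hUE⟩)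
  · intro D
    obtain ⟨N, hN, hNκ, hD, -, b, hb⟩ := hex D D
    rw [key N hN hNκ _ hD b hb, key N hN hNκ _ hD.compl b hb, rdiv_compl, has_compl]

/-- The set `rdiv hmul E c` is definable over `N'`, which contains `c`, so whether `b` lies in it is
decided by `p`. -/
theorem ProdSpec.tp_mul (h : ProdSpec hmul κ N₀ p q r) (hN : N₀ ⊆ N) {N' : Set G} (hN' : N ⊆ N')
    (hNκ : #N < κ) {b c : Fin 1 → G} (hc : tp N c = resType (Set.subset_univ N) q)
    (hc' : ∀ i, c i ∈ N') (hb : tp N' b = resType (Set.subset_univ N') p) :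
    (tp N (b * c) : TypeSpace L N (Fin 1)) = resType (Set.subset_univ N) r := by
  refine type_ext fun E hE => ?_
  rw [has_resType, h N hN hNκ _ E.2 c hc]
  let E' : L.DefinableSet N' (Fin 1) :=
    ⟨_, definable_mul_right_preimage hmul (E.2.mono hN') hc'⟩
  have h1 : b ∈ E' := (has_tp.1 hE : b * c ∈ E)
  rw [mem_iff_of_tp_eq hb, has_resType] at h1
  exact h1

theorem mk_union_range_lt (hκ : ℵ₀ < κ) (hN : #N < κ) (c : Fin 1 → G) :
    #(N ∪ Set.range c : Set G) < κ :=
  mk_union_lt hκ hN (mk_lt_of_finite hκ (Set.finite_range c))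

/-- With `c` realizing `r` over `N` and `b` realizing `q` over `N` and `c`, both bracketings contain
`D` exactly when `p` contains `rdiv hmul D (b * c)`. -/
theorem ProdSpec.assoc (hκ : ℵ₀ < κ) (hsat : IsSaturated L G κ) (hN₀ : #N₀ < κ)
    (hpq : ProdSpec hmul κ N₀ p q s) (hsr : ProdSpec hmul κ N₀ s r t)
    (hqr : ProdSpec hmul κ N₀ q r x) (hpx : ProdSpec hmul κ N₀ p x y) : t = y := by
  refine type_ext fun D hD => ?_
  obtain ⟨A, hA, hAD⟩ := exists_finite_definable D
  have hN : N₀ ⊆ N₀ ∪ A := Set.subset_union_left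
  have hNκ : #(N₀ ∪ A : Set G) < κ := mk_union_lt hκ hN₀ (mk_lt_of_finite hκ hA)
  replace hAD := hAD.mono (Set.subset_union_right (s := N₀))
  generalize N₀ ∪ A = N at hN hNκ hAD
  obtain ⟨c, hc⟩ := hsat N hNκ 1 (resType (Set.subset_univ N) r)
  have hNκ' := mk_union_range_lt hκ hNκ c
  have hNN' : N ⊆ N ∪ Set.range c := Set.subset_union_left
  have hc' : ∀ i, c i ∈ N ∪ Set.range c := fun i => Or.inr ⟨i, rfl⟩
  obtain ⟨b, hb⟩ := hsat _ hNκ' 1 (resType (Set.subset_univ _) q)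
  rw [hpx N hN hNκ D hAD _ (hqr.tp_mul hN hNN' hNκ hc hc' hb), ← rdiv_rdiv,
    ← hpq _ (hN.trans hNN') hNκ' _ (definable_mul_right_preimage hmul (hAD.mono hNN') hc') b hb,
    ← hsr N hN hNκ D hAD c hc]
  exact hD

theorem ProdSpec.isTypeProduct (hκ : ℵ₀ < κ)
    (hL : Cardinal.lift.{w} L.card < Cardinal.lift.{max u v} κ) (hsat : IsSaturated L G κ)
    (hN₀ : #N₀ < κ) (hp : TypeInvariantOver p N₀) (h : ProdSpec hmul κ N₀ p q r) :
    IsTypeProduct κ p q r := by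
  refine ⟨fun D => ?_, fun D N hN ψ hψ hB => ?_⟩
  · obtain ⟨A, hA, hAD⟩ := exists_finite_definable D
    obtain ⟨N, hAN, hN⟩ := exists_elementarySubstructure_mk_lt hκ hL
      (mk_union_lt hκ hN₀ (mk_lt_of_finite hκ hA))
    refine ⟨N, hN, ⟨_, definable_mulFormula hmul
      (hAD.mono (Set.subset_union_right.trans hAN))⟩, rfl, ?_, ?_⟩
    · rintro _ - d d' rfl hd
      exact measureInvariantOver_dirac.2 (hp.mono (Set.subset_union_left.trans hAN)) 1 _ _ _
        hd.symm
    · have : Subsingleton (restr (dirac q) (N : Set G)).supp := by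
        rw [supp_restrict_dirac]
        infer_instance
      exact Subsingleton.measurable
  · obtain ⟨A, hA, hAD⟩ := exists_finite_definable D
    -- The witness `N` need not contain `N₀`, so `q` is realized over a larger set. That `fiberMap`
    -- can be computed at this realization comes from the Borel hypothesis on `ψ`, not from
    -- invariance.
    have hs : #(N ∪ (N₀ ∪ A) : Set G) < κ :=
      mk_union_lt hκ hN (mk_union_lt hκ hN₀ (mk_lt_of_finite hκ hA))
    obtain ⟨b, hb⟩ := hsat _ hs 1 (resType (Set.subset_univ _) q)
    have hbN : tp (N : Set G) b = resType (Set.subset_univ _) q := by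
      rw [← resType_tp (L := L) Set.subset_union_left b, hb, resType_resType]
    have h1 : Has r D ↔ Has p (rdiv hmul D b) := by
      refine h _ (Set.subset_union_left.trans Set.subset_union_right) hs D
        (hAD.mono (Set.subset_union_right.trans Set.subset_union_right)) b hb
    have h2 := (restr (dirac q) (N : Set G)).borel_supp
    have h3 := hB.1
    rw [productValue]
    rw [supp_restrict_dirac] at h2 h3 ⊢
    rw [integral_singleton, measureReal_def, h2,
      fiberMap_eq hbN fun b' hb' => h3 _ rfl b' b hb' hbN, inst_eq_rdiv hmul hψ,
      dirac_eq_iff.2 h1]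
    simp

end Translates

/-! ### Idempotence as a mean value property, and closed ideals. -/

section Idempotent

variable {L : FirstOrder.Language.{u, v}} {G : Type w} [L.Structure G] [Group G]
  {hmul : (∅ : Set G).DefinableFun L (fun z : Fin 2 → G => z 0 * z 1)}
  {κ : Cardinal.{w}} {N₀ : Set G} {μ : GlobalMeasure L G (Fin 1)}

/-- Over `N`, the measure of a definable set is the integral of the measures of its translates,
which depend continuously on the type over `N`. -/
def HasTranslateIntegral
    (hmul : (∅ : Set G).DefinableFun L (fun z : Fin 2 → G => z 0 * z 1))
    (μ : GlobalMeasure L G (Fin 1)) (N : Set G) : Prop :=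
  ∀ D : GlobalDef L G (Fin 1), N.Definable L (D : Set (Fin 1 → G)) →
    ∃ f : TypeSpace L N (Fin 1) → ℝ, Continuous f ∧
      (∀ b : Fin 1 → G, f (tp N b) = μ (rdiv hmul D b)) ∧
      (μ D : ℝ) = ∫ q in (restr μ N).supp, f q ∂(restr μ N).borel

/-- Definability and idempotence enter the argument only here. A small submodel containing a
definability witness inherits continuity, so it witnesses the Borel condition and idempotence
applies over it. -/
theorem exists_hasTranslateIntegral (hκ : ℵ₀ < κ)
    (hL : Cardinal.lift.{w} L.card < Cardinal.lift.{max u v} κ) (hsat : IsSaturated L G κ)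
    (hdef : IsDefinable κ μ) (hidem : IsIdempotent κ μ) {A : Set G} (hA : #A < κ) :
    ∃ N : Set G, A ⊆ N ∧ #N < κ ∧ HasTranslateIntegral hmul μ N := by
  obtain ⟨N₁, hN₁, hinv, hcont⟩ := hdef
  obtain ⟨N, hAN, hN⟩ := exists_elementarySubstructure_mk_lt hκ hL (mk_union_lt hκ hA hN₁)
  have h1 : (N₁ : Set G) ⊆ N := Set.subset_union_right.trans hAN
  refine ⟨N, Set.subset_union_left.trans hAN, hN, fun D hD => ?_⟩
  let ψ : L.DefinableSet (N : Set G) (Fin 1 ⊕ Fin 1) := ⟨_, definable_mulFormula hmul hD⟩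
  have hc : Continuous (fiberMap μ ψ) :=
    continuous_fiberMap_of_subset hinv hcont h1 (hsat _ hN 1) ψ
  refine ⟨fiberMap μ ψ, hc, fun b => ?_, hidem.2 D N hN ψ rfl ⟨?_, ?_⟩⟩
  · rw [(hinv.mono h1).fiberMap_tp, inst_eq_rdiv (D := D) hmul rfl]
  · rintro _ - d d' rfl hd
    exact hinv.mono h1 1 ψ d d' hd.symm
  · exact hc.measurable.comp measurable_subtype_coe

/-- If `μ D` were `0`, the nonnegative continuous integrand would vanish on the support, in
particular at `q|N`; its value there is the measure of a translate that lies in `p`. -/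
theorem ProdSpec.mem_supp (hκ : ℵ₀ < κ) (hsat : IsSaturated L G κ) (hN₀ : #N₀ < κ)
    (hμ : ∀ A : Set G, #A < κ → ∃ N : Set G, A ⊆ N ∧ #N < κ ∧ HasTranslateIntegral hmul μ N)
    {p q r : TypeSpace L (Set.univ : Set G) (Fin 1)} (hp : p ∈ μ.supp) (hq : q ∈ μ.supp)
    (h : ProdSpec hmul κ N₀ p q r) : r ∈ μ.supp := by
  intro D hD
  obtain ⟨A, hA, hAD⟩ := exists_finite_definable D
  obtain ⟨N, hAN, hN, hI⟩ := hμ _ (mk_union_lt hκ hN₀ (mk_lt_of_finite hκ hA))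
  have hND := hAD.mono (Set.subset_union_right.trans hAN)
  obtain ⟨f, hf, hfb, hfi⟩ := hI D hND
  obtain ⟨b, hb⟩ := hsat N hN 1 (resType (Set.subset_univ N) q)
  have hpos := hp _ ((h N (Set.subset_union_left.trans hAN) hN D hND b hb).1 hD)
  by_contra h0
  rw [nonpos_iff_eq_zero.1 (not_lt.1 h0), NNReal.coe_zero] at hfi
  have h1 := (restr μ N).eq_zero_of_integral_eq_zero hf (fun x _ => by
    obtain ⟨a, rfl⟩ := hsat N hN 1 x
    rw [hfb]
    exact NNReal.coe_nonneg _) hfi.symm _ (μ.resType_mem_supp (Set.subset_univ N) hq)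
  rw [← hb, hfb, NNReal.coe_eq_zero] at h1
  exact hpos.ne' h1

theorem eq_univ_of_isClosed_ideal (hκ : ℵ₀ < κ) (hsat : IsSaturated L G κ) (hN₀ : #N₀ < κ)
    (hμ : ∀ A : Set G, #A < κ → ∃ N : Set G, A ⊆ N ∧ #N < κ ∧ HasTranslateIntegral hmul μ N)
    {mul : μ.supp → μ.supp → μ.supp}
    (hmulspec : ∀ p q : μ.supp, ProdSpec hmul κ N₀ p.1 q.1 (mul p q).1)
    {I : Set μ.supp} (hne : I.Nonempty) (hcl : IsClosed I)
    (hI : ∀ p i : μ.supp, i ∈ I → mul p i ∈ I ∧ mul i p ∈ I) : I = Set.univ := by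
  by_contra hIne
  obtain ⟨p₀, hp₀⟩ := (Set.ne_univ_iff_exists_notMem I).1 hIne
  obtain ⟨i, hi⟩ := hne
  obtain ⟨D, hpD, hDI⟩ := exists_basic_of_mem (p := p₀.1)
    (μ.isClosed_supp.isClosedEmbedding_subtypeVal.isClosedMap I hcl).isOpen_compl
    (by rintro ⟨x, hx, hxp⟩; exact hp₀ (Subtype.ext hxp ▸ hx))
  obtain ⟨A, hA, hAD⟩ := exists_finite_definable D
  obtain ⟨N, hAN, hN, hNI⟩ := hμ _ (mk_union_lt hκ hN₀ (mk_lt_of_finite hκ hA))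
  have hN₀N : N₀ ⊆ N := Set.subset_union_left.trans hAN
  replace hAD := hAD.mono (Set.subset_union_right.trans hAN)
  obtain ⟨f, hf, hfb, hfi⟩ := hNI D hAD
  obtain ⟨r, hr, hmax⟩ := μ.isClosed_supp.isCompact.exists_isMaxOn ⟨p₀.1, p₀.2⟩
    (hf.comp (continuous_resType (Set.subset_univ N))).continuousOn
  replace hmax : ∀ p ∈ μ.supp, f (resType (Set.subset_univ N) p) ≤
    f (resType (Set.subset_univ N) r) := fun p hp => hmax hp
  obtain ⟨c, hc⟩ := hsat N hN 1 (resType (Set.subset_univ N) r)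
  -- The translate by `c` needs `c` as a parameter, so the mean value property is applied to it over
  -- a larger `N'`.
  obtain ⟨N', hNN', hN', hNI'⟩ := hμ _ (mk_union_range_lt hκ hN c)
  have hNs : N ⊆ N' := Set.subset_union_left.trans hNN'
  have hcN' : ∀ j, c j ∈ N' := fun j => hNN' (Or.inr ⟨j, rfl⟩)
  obtain ⟨g, hg, hgb, hgi⟩ := hNI' (rdiv hmul D c)
    (definable_mul_right_preimage hmul (hAD.mono hNs) hcN')
  -- The function `g` is at most its mean, the maximal value of `f`, so it is constant.
  have hle : ∀ x ∈ (restr μ N').supp, g x ≤ μ (rdiv hmul D c) := by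
    intro x hx
    obtain ⟨q, hq, rfl⟩ := μ.exists_resType_eq _ hx
    obtain ⟨b, hb⟩ := hsat N' hN' 1 (resType (Set.subset_univ N') q)
    rw [← hb, hgb, rdiv_rdiv, ← hfb, ← hfb, hc,
      (hmulspec ⟨q, hq⟩ ⟨r, hr⟩).tp_mul hN₀N hNs hN hc hcN' hb]
    exact hmax _ (mul _ _).2
  have hint : ∫ x in (restr μ N').supp, ((μ (rdiv hmul D c) : ℝ) - g x) ∂(restr μ N').borel =
      0 := by
    rw [integral_sub ((restr μ N').integrableOn_supp continuous_const)
      ((restr μ N').integrableOn_supp hg), ← hgi, setIntegral_const, measureReal_def,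
      KeislerMeasure.borel_supp]
    simp
  have hconst := (restr μ N').eq_zero_of_integral_eq_zero (continuous_const.sub hg)
    (fun x hx => sub_nonneg.2 (hle x hx)) hint _ (μ.resType_mem_supp (Set.subset_univ N') i.2)
  -- It vanishes on the ideal.
  obtain ⟨b, hb⟩ := hsat N' hN' 1 (resType (Set.subset_univ N') i.1)
  have hbc := (hmulspec i ⟨r, hr⟩).tp_mul hN₀N hNs hN hc hcN' hb
  have hzero : μ (rdiv hmul D (b * c)) = 0 := by
    by_contra hpos
    obtain ⟨p, hp, hpD'⟩ := μ.exists_mem_supp (pos_iff_ne_zero.2 hpos)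
    -- Both sides of the ideal property are used: `i * r ∈ I`, and then `p * (i * r) ∈ I`.
    have hj := (hI ⟨p, hp⟩ _ (hI ⟨r, hr⟩ i hi).2).1
    exact hDI ((hmulspec ⟨p, hp⟩ _ N hN₀N hN D hAD _ hbc).2 hpD') ⟨_, hj, rfl⟩
  rw [Pi.sub_apply, ← hb, hgb, rdiv_rdiv, hzero, NNReal.coe_zero, sub_zero, ← hfb, hc] at hconst
  -- The maximum of `f` is now known to be `0`, so its integral `μ D` vanishes, against `D ∈ p₀`.
  have hf0 : ∀ x ∈ (restr μ N).supp, f x = 0 := by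
    intro x hx
    obtain ⟨q, hq, rfl⟩ := μ.exists_resType_eq _ hx
    refine le_antisymm (hconst ▸ hmax q hq) ?_
    obtain ⟨a, ha⟩ := hsat N hN 1 (resType (Set.subset_univ N) q)
    rw [← ha, hfb]
    exact NNReal.coe_nonneg _
  rw [setIntegral_congr_fun (restr μ N).isClosed_supp.measurableSet hf0, integral_zero,
    NNReal.coe_eq_zero] at hfi
  exact (p₀.2 D hpD).ne' hfi

end Idempotent

end KeislerConv

end

theorem mainTheorem2 {L : FirstOrder.Language.{u, v}} {G : Type w} [L.Structure G] [Group G]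
    (hmul : (∅ : Set G).DefinableFun L (fun z : Fin 2 → G => z 0 * z 1))
    (κ : Cardinal.{w}) (hκ : ℵ₀ < κ)
    (hL : Cardinal.lift.{w} L.card < Cardinal.lift.{max u v} κ)
    (hsat : KeislerConv.IsSaturated L G κ)
    (μ : KeislerConv.GlobalMeasure L G (Fin 1))
    (hdef : KeislerConv.IsDefinable κ μ)
    (hsupp : KeislerConv.IsInvariantlySupported κ μ)
    (hidem : KeislerConv.IsIdempotent κ μ) :
    ∃ _ : Semigroup μ.supp,
      (∀ p q : μ.supp, KeislerConv.IsTypeProduct κ p.1 q.1 (p * q : μ.supp).1) ∧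
      ∀ I : Set μ.supp, I.Nonempty → IsClosed I →
        (∀ p i : μ.supp, i ∈ I → p * i ∈ I ∧ i * p ∈ I) → I = Set.univ := by
  obtain ⟨N₀, hN₀, hinv⟩ := hsupp
  have hμ := fun (A : Set G) (hA : #A < κ) =>
    KeislerConv.exists_hasTranslateIntegral (hmul := hmul) hκ hL hsat hdef hidem hA
  have hex : ∀ p q : μ.supp,
      ∃ r : μ.supp, KeislerConv.ProdSpec hmul κ (N₀ : Set G) p.1 q.1 r.1 := by
    intro p q
    obtain ⟨r, hr⟩ := KeislerConv.exists_prodSpec (hmul := hmul) hκ hsat hN₀ (hinv p.1 p.2) q.1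
    exact ⟨⟨r, hr.mem_supp hκ hsat hN₀ hμ p.2 q.2⟩, hr⟩
  choose mul hspec using hex
  refine ⟨{ mul := mul, mul_assoc := fun p q r => ?_ }, fun p q => ?_, fun I hne hcl hI => ?_⟩
  · exact Subtype.ext ((hspec p q).assoc hκ hsat hN₀ (hspec _ r) (hspec q r) (hspec p _))
  · exact (hspec p q).isTypeProduct hκ hL hsat hN₀ (hinv p.1 p.2)
  · exact KeislerConv.eq_univ_of_isClosed_ideal hκ hsat hN₀ hμ hspec hne hcl hI
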